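/- Let $k$ be an algebraically closed field of characteristic $0$ and let $A=k\{x,y\}/(xy-yx-1)$ be the first Weyl algebra, $\mathbb Z$-graded by $\deg x=1$, $\deg y=-1$. Put $z=xy\in A_0$. Let $\operatorname{gr-}A$ be the $k$-linear category of all $\mathbb Z$-graded right $A$-modules with degree-preserving $A$-linear maps, and for a graded module $M$ and $n\in\mathbb Z$ let $M\langle n\rangle$ be the shifted module with $M\langle n\rangle_j=M_{j-n}$. Consider the graded modules $X=A/xA$, $Y=(A/yA)\langle 1\rangle$ and, for $\lambda\in k$, $M_\lambda=A/(z+\lambda)A$. **Theorem.** Let $\mathcal F:\operatorname{gr-}A\to\operatorname{gr-}A$ be a $k$-linear autoequivalence. Then there are integers $a\in\{1,-1\}$ and $b$ such that, for every $n\in\mathbb Z$, the pairs $\{\mathcal F(X\langle n\rangle),\mathcal F(Y\langle n\rangle)\}$ and $\{X\langle an+b\rangle,Y\langle an+b\rangle\}$ agree up to isomorphism, i.e. either $$\mathcal F(X\langle n\rangle)\cong X\langle an+b\rangle\ \text{ and }\ \mathcal F(Y\langle n\rangle)\cong Y\langle an+b\rangle,$$ or $$\mathcal F(X\langle n\rangle)\cong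 Y\langle an+b\rangle\ \text{ and }\ \mathcal F(Y\langle n\rangle)\cong X\langle an+b\rangle,$$ and such that, for every $\lambda\in k\smallsetminus\mathbb Z$, $$\mathcal F(M_\lambda)\cong M_{a\lambda+b}.$$ The integers $a=\pm1$ and $b$ are unique; indeed they are already determined by the condition on the pairs $\{X\langle n\rangle,Y\langle n\rangle\}$. -/

import Mathlib

open CategoryTheory
open scoped DirectSum

universe u

/-! ## Graded right modules over a `ℤ`-graded `k`-algebra -/

section GradedModules

variable {k : Type u} [Field k] {R : Type u} [Ring R] [Algebra k R]

/-- A `ℤ`-graded right module over the graded `k`-algebra `R = ⨁ 𝒜 i`: a right `R`-module `M`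
(that is, an `Rᵐᵒᵖ`-module), with the `k`-vector space structure coming from `k → R`, and
`k`-subspaces `M_i` such that `M = ⨁ M_i` and `M_i R_j ⊆ M_{i+j}`. -/
structure GrMod (𝒜 : ℤ → Submodule k R) where
  /-- the underlying set -/
  carrier : Type u
  [addCommGroup : AddCommGroup carrier]
  [moduleBase : Module k carrier]
  [moduleOp : Module Rᵐᵒᵖ carrier]
  [isScalarTower : IsScalarTower k Rᵐᵒᵖ carrier]
  /-- the homogeneous components -/
  comp : ℤ → Submodule k carrier
  isInternal : DirectSum.IsInternal comp
  smul_mem : ∀ (i j : ℤ) (m : carrier) (r : R), m ∈ comp i → r ∈ 𝒜 j →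
    MulOpposite.op r • m ∈ comp (i + j)

namespace GrMod

attribute [instance] addCommGroup moduleBase moduleOp isScalarTower

variable {𝒜 : ℤ → Submodule k R}

/-- The `k`-space of `R`-linear maps `M → N` that preserve degrees. -/
def homs (M N : GrMod 𝒜) : Submodule k (M.carrier →ₗ[Rᵐᵒᵖ] N.carrier) where
  carrier := {f | ∀ (i : ℤ) (m : M.carrier), m ∈ M.comp i → f m ∈ N.comp i}
  add_mem' hf hg i m hm := (N.comp i).add_mem (hf i m hm) (hg i m hm)
  zero_mem' i _ _ := (N.comp i).zero_mem
  smul_mem' c _ hf i m hm := (N.comp i).smul_mem c (hf i m hm)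

/-- The category `gr-R` of graded right `R`-modules and degree preserving homomorphisms. -/
instance : Category (GrMod 𝒜) where
  Hom M N := homs M N
  id M := ⟨LinearMap.id, fun _ _ hm => hm⟩
  comp f g := ⟨g.1.comp f.1, fun i m hm => g.2 i _ (f.2 i m hm)⟩

instance (M N : GrMod 𝒜) : AddCommGroup (M ⟶ N) :=
  inferInstanceAs (AddCommGroup (homs M N))

instance : Preadditive (GrMod 𝒜) where
  homGroup _ _ := inferInstance
  add_comp _ _ _ f g h := Subtype.ext (LinearMap.comp_add f.1 g.1 h.1)
  comp_add _ _ _ f g h := Subtype.ext (LinearMap.add_comp f.1 h.1 g.1)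

instance : Linear k (GrMod 𝒜) where
  homModule M N := inferInstanceAs (Module k (homs M N))
  smul_comp M N P c f g := Subtype.ext <| LinearMap.ext fun m => by
    change g.1 (c • f.1 m) = c • g.1 (f.1 m)
    rw [← algebraMap_smul Rᵐᵒᵖ c (f.1 m), map_smul, algebraMap_smul]
  comp_smul _ _ _ _ _ _ := rfl

/-- The shift `M⟨n⟩`, with the convention `M⟨n⟩_j = M_{j-n}`. -/
def shift (M : GrMod 𝒜) (n : ℤ) : GrMod 𝒜 where
  carrier := M.carrier
  comp j := M.comp (j - n)
  isInternal := by
    have h := (DirectSum.isInternal_submodule_iff_iSupIndep_and_iSup_eq_top M.comp).1 M.isInternal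
    refine (DirectSum.isInternal_submodule_iff_iSupIndep_and_iSup_eq_top _).2 ⟨?_, ?_⟩
    · exact h.1.comp (f := fun j : ℤ => j - n) (fun a b hab => by simpa using hab)
    · rw [← h.2]
      exact (Equiv.subRight n).iSup_comp (g := M.comp)
  smul_mem i j m r hm hr := by
    have h := M.smul_mem (i - n) j m r hm hr
    rwa [show i - n + j = i + j - n by ring] at h

section Quotient

variable [GradedAlgebra 𝒜]

/-- The right ideal `aR`. -/
def rightIdeal (a : R) : Submodule Rᵐᵒᵖ R := Submodule.span Rᵐᵒᵖ {a}

theorem mem_rightIdeal {a r : R} : r ∈ rightIdeal a ↔ ∃ s : R, a * s = r := by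
  rw [rightIdeal, Submodule.mem_span_singleton]
  exact ⟨fun ⟨s, hs⟩ => ⟨s.unop, hs⟩, fun ⟨s, hs⟩ => ⟨MulOpposite.op s, hs⟩⟩

variable (𝒜) in
/-- The degree `i` part of `R/aR`: the image of `R_i`. -/
def quotComp (a : R) (i : ℤ) : Submodule k (R ⧸ rightIdeal a) :=
  (𝒜 i).map ((rightIdeal a).mkQ.restrictScalars k)

theorem proj_mem_rightIdeal {a : R} {d : ℤ} (ha : a ∈ 𝒜 d) {r : R} (hr : r ∈ rightIdeal a)
    (i : ℤ) : (DirectSum.decompose 𝒜 r i : R) ∈ rightIdeal a := by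
  obtain ⟨s, rfl⟩ := mem_rightIdeal.1 hr
  refine mem_rightIdeal.2 ⟨DirectSum.decompose 𝒜 s (i - d), ?_⟩
  have h := DirectSum.coe_decompose_mul_add_of_left_mem 𝒜 (j := i - d) (b := s) ha
  rw [show d + (i - d) = i by ring] at h
  exact h.symm

theorem quot_isInternal {a : R} {d : ℤ} (ha : a ∈ 𝒜 d) :
    DirectSum.IsInternal (quotComp 𝒜 a) := by
  classical
  refine (DirectSum.isInternal_submodule_iff_iSupIndep_and_iSup_eq_top _).2 ⟨?_, ?_⟩
  · rw [iSupIndep_iff_forall_dfinsupp]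
    intro i x v hv
    obtain ⟨r, hr, hx⟩ := x.2
    have key : ∀ v : Π₀ j, quotComp 𝒜 a j, ∃ s : R, (DirectSum.decompose 𝒜 s i : R) ∈ rightIdeal a
        ∧ (rightIdeal a).mkQ s =
          DFinsupp.lsum ℕ (fun j => (quotComp 𝒜 a j).subtype.restrictScalars ℕ) (v.erase i) := by
      intro v
      induction v using DFinsupp.induction with
      | h0 => exact ⟨0, by simp, by simp⟩
      | ha j b f hf hb ih =>
        obtain ⟨s, hs, hs'⟩ := ih
        by_cases hij : j = i
        · subst hij
          refine ⟨s, hs, ?_⟩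
          rw [hs']
          simp
        · obtain ⟨t, ht, ht'⟩ := b.2
          refine ⟨t + s, ?_, ?_⟩
          · rw [DirectSum.decompose_add, DirectSum.add_apply, Submodule.coe_add,
              DirectSum.decompose_of_mem_ne 𝒜 ht hij, zero_add]
            exact hs
          · rw [map_add, hs', DFinsupp.erase_add, map_add, DFinsupp.erase_single_ne _ hij]
            simp only [DFinsupp.lsum_single]
            congr 1
    obtain ⟨s, hs, hs'⟩ := key v
    have h1 : (rightIdeal a).mkQ s = (rightIdeal a).mkQ r := by
      rw [hs']; exact hv.trans hx.symm
    have h2 : s - r ∈ rightIdeal a := (Submodule.Quotient.eq _).1 h1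
    have h3 := proj_mem_rightIdeal ha h2 i
    rw [DirectSum.decompose_sub, DirectSum.sub_apply, Submodule.coe_sub,
      DirectSum.decompose_of_mem_same 𝒜 hr] at h3
    have h4 : r ∈ rightIdeal a := by
      have := (rightIdeal a).sub_mem hs h3
      rwa [sub_sub_cancel] at this
    apply Subtype.ext
    rw [← hx]
    exact (Submodule.Quotient.mk_eq_zero _).2 h4
  · have h := (DirectSum.Decomposition.isInternal 𝒜).submodule_iSup_eq_top
    unfold quotComp
    rw [← Submodule.map_iSup, h, Submodule.map_top]
    exact LinearMap.range_eq_top.2 (rightIdeal a).mkQ_surjective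

/-- The graded right module `R/aR`, for a homogeneous element `a`, with the induced grading. -/
def quot (a : R) (d : ℤ) (ha : a ∈ 𝒜 d) : GrMod 𝒜 where
  carrier := R ⧸ rightIdeal a
  comp := quotComp 𝒜 a
  isInternal := quot_isInternal ha
  smul_mem := by
    rintro i j _ r ⟨m, hm, rfl⟩ hr
    exact ⟨m * r, SetLike.mul_mem_graded hm hr, rfl⟩

end Quotient

end GrMod

end GradedModules

/-! ## The first Weyl algebra with the Euler grading -/

section Weyl

variable (k : Type u) [Field k]

/-- The two generators of the Weyl algebra. -/
inductive WeylGen : Type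
  | x
  | y

/-- The Euler degrees: `deg x = 1`, `deg y = -1`. -/
def WeylGen.deg : WeylGen → ℤ
  | x => 1
  | y => -1

/-- The defining relation `xy = yx + 1`. -/
inductive WeylRel : FreeAlgebra k WeylGen → FreeAlgebra k WeylGen → Prop
  | rel : WeylRel
      (FreeAlgebra.ι k WeylGen.x * FreeAlgebra.ι k WeylGen.y)
      (FreeAlgebra.ι k WeylGen.y * FreeAlgebra.ι k WeylGen.x + 1)

/-- The first Weyl algebra `A = k{x, y}/(xy - yx - 1)`. -/
def Weyl : Type u := RingQuot (WeylRel k)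

noncomputable instance : Ring (Weyl k) := inferInstanceAs (Ring (RingQuot (WeylRel k)))

noncomputable instance : Algebra k (Weyl k) :=
  inferInstanceAs (Algebra k (RingQuot (WeylRel k)))

namespace Weyl

/-- The image of a generator in `A`. -/
noncomputable def gen (g : WeylGen) : Weyl k :=
  RingQuot.mkAlgHom k (WeylRel k) (FreeAlgebra.ι k g)

/-- The universal property: elements `p`, `q` with `pq = qp + 1` in a `k`-algebra `B` define an
algebra map `A → B`. -/
noncomputable def lift {B : Type*} [Ring B] [Algebra k B] (v : WeylGen → B)
    (hv : v .x * v .y = v .y * v .x + 1) : Weyl k →ₐ[k] B :=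
  RingQuot.liftAlgHom k (s := WeylRel k) ⟨FreeAlgebra.lift k v, by
    rintro _ _ ⟨⟩
    simp only [map_mul, map_add, map_one, FreeAlgebra.lift_ι_apply]
    exact hv⟩

theorem lift_gen {B : Type*} [Ring B] [Algebra k B] (v : WeylGen → B)
    (hv : v .x * v .y = v .y * v .x + 1) (g : WeylGen) : lift k v hv (gen k g) = v g :=
  (RingQuot.liftAlgHom_mkAlgHom_apply k _ _ _).trans (FreeAlgebra.lift_ι_apply _ _)

theorem hom_ext {B : Type*} [Ring B] [Algebra k B] {f f' : Weyl k →ₐ[k] B}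
    (h : ∀ g, f (gen k g) = f' (gen k g)) : f = f' :=
  RingQuot.ringQuot_ext' k (s := WeylRel k) f f' (FreeAlgebra.hom_ext (funext h))

/-- The generator `x` of `A`. -/
noncomputable def x : Weyl k := gen k WeylGen.x

/-- The generator `y` of `A`. -/
noncomputable def y : Weyl k := gen k WeylGen.y

theorem x_mul_y : x k * y k = y k * x k + 1 := by
  have h := RingQuot.mkAlgHom_rel k (WeylRel.rel (k := k))
  rw [map_mul, map_add, map_mul, map_one] at h
  exact h

/-- The element `z = xy`. -/
noncomputable def z : Weyl k := x k * y k

/-- The homogeneous component `A_n` of the Euler grading: the span of all words in `x` and `y`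
whose total degree is `n`. -/
noncomputable def grading (n : ℤ) : Submodule k (Weyl k) :=
  Submodule.span k {a | ∃ w : List WeylGen, (w.map WeylGen.deg).sum = n ∧ (w.map (gen k)).prod = a}

theorem word_mem (w : List WeylGen) :
    (w.map (gen k)).prod ∈ grading k (w.map WeylGen.deg).sum :=
  Submodule.subset_span ⟨w, rfl, rfl⟩

theorem gen_mem (g : WeylGen) : gen k g ∈ grading k g.deg := by
  simpa using word_mem k [g]

instance gradedMonoid : SetLike.GradedMonoid (grading k) where
  one_mem := by simpa using word_mem k []
  mul_mem i j a b ha hb := by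
    have h : grading k i * grading k j ≤ grading k (i + j) := by
      unfold grading
      rw [Submodule.span_mul_span]
      refine Submodule.span_mono ?_
      rintro _ ⟨_, ⟨v, rfl, rfl⟩, _, ⟨w, rfl, rfl⟩, rfl⟩
      exact ⟨v ++ w, by simp, by simp⟩
    exact h (Submodule.mul_mem_mul ha hb)

/-- A generator, as an element of the direct sum of the components. -/
noncomputable def genSum (g : WeylGen) : ⨁ n, grading k n :=
  DirectSum.of (fun n => grading k n) g.deg ⟨gen k g, gen_mem k g⟩

theorem genSum_rel :
    genSum k .x * genSum k .y = genSum k .y * genSum k .x + 1 := by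
  have h3 : genSum k .x * genSum k .y = DirectSum.of (fun n => grading k n) (1 + -1)
      ⟨gen k .x * gen k .y, SetLike.mul_mem_graded (gen_mem k .x) (gen_mem k .y)⟩ :=
    DirectSum.of_mul_of _ _
  have h2 : genSum k .y * genSum k .x = DirectSum.of (fun n => grading k n) (-1 + 1)
      ⟨gen k .y * gen k .x, SetLike.mul_mem_graded (gen_mem k .y) (gen_mem k .x)⟩ :=
    DirectSum.of_mul_of _ _
  have h1 : (1 : ⨁ n, grading k n) = DirectSum.of (fun n => grading k n) 0
    ⟨1, SetLike.GradedOne.one_mem⟩ := rfl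
  have h4 : ∀ (n : ℤ) (hn : n = 0) (a : Weyl k) (ha : a ∈ grading k n),
      DirectSum.of (fun n => grading k n) n ⟨a, ha⟩ =
        DirectSum.of (fun n => grading k n) 0 ⟨a, hn ▸ ha⟩ := by
    rintro n rfl a ha
    rfl
  rw [h3, h2, h1, h4 (1 + -1) (by norm_num), h4 (-1 + 1) (by norm_num), ← map_add]
  congr 1
  exact Subtype.ext (x_mul_y k)

/-- The decomposition of an element of `A` into its homogeneous components. -/
noncomputable def toSum : Weyl k →ₐ[k] ⨁ n, grading k n :=
  lift k (genSum k) (genSum_rel k)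

theorem toSum_gen (g : WeylGen) : toSum k (gen k g) = genSum k g :=
  lift_gen k _ _ g

theorem toSum_word (w : List WeylGen) :
    toSum k (w.map (gen k)).prod =
      DirectSum.of (fun n => grading k n) (w.map WeylGen.deg).sum ⟨_, word_mem k w⟩ := by
  induction w with
  | nil => simp only [List.map_nil, List.prod_nil, map_one]; rfl
  | cons g w ih =>
    simp only [List.map_cons, List.prod_cons, map_mul]
    rw [ih, toSum_gen, genSum, DirectSum.of_mul_of]
    rfl

/-- The Weyl algebra is a `ℤ`-graded `k`-algebra. -/
noncomputable instance gradedAlgebra : GradedAlgebra (grading k) :=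
  GradedAlgebra.ofAlgHom (grading k) (toSum k)
    (by
      refine hom_ext k fun g => ?_
      change DirectSum.coeAlgHom (grading k) (toSum k (gen k g)) = gen k g
      rw [toSum_gen, genSum, DirectSum.coeAlgHom_of])
    (by
      rintro i ⟨a, ha⟩
      dsimp only
      induction ha using Submodule.span_induction with
      | mem a h =>
        obtain ⟨w, rfl, rfl⟩ := h
        exact toSum_word k w
      | zero => rw [map_zero]; exact (map_zero (DirectSum.of (fun n => grading k n) i)).symm
      | add a b ha hb iha ihb =>
        rw [map_add, iha, ihb, ← map_add]
        rfl
      | smul c a ha iha =>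
        rw [map_smul, iha]
        exact (DirectSum.lof k ℤ (fun n => grading k n) i).map_smul c ⟨a, ha⟩ |>.symm)

theorem x_mem : x k ∈ grading k 1 := gen_mem k WeylGen.x

theorem y_mem : y k ∈ grading k (-1) := gen_mem k WeylGen.y

theorem z_add_mem (c : k) : z k + algebraMap k (Weyl k) c ∈ grading k 0 := by
  have h1 : x k * y k ∈ grading k (1 + -1) := SetLike.mul_mem_graded (x_mem k) (y_mem k)
  rw [add_neg_cancel] at h1
  rw [Algebra.algebraMap_eq_smul_one]
  exact (grading k 0).add_mem h1 ((grading k 0).smul_mem c SetLike.GradedOne.one_mem)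

end Weyl

/-- The category `gr-A` of graded right modules over the Weyl algebra. -/
abbrev GrWeyl : Type (u + 1) := GrMod (Weyl.grading k)

namespace GrWeyl

/-- `X = A/xA`. -/
noncomputable def X : GrWeyl k := GrMod.quot (Weyl.x k) 1 (Weyl.x_mem k)

/-- `Y = (A/yA)⟨1⟩`. -/
noncomputable def Y : GrWeyl k := (GrMod.quot (Weyl.y k) (-1) (Weyl.y_mem k)).shift 1

/-- `M_c = A/(z + c)A`. -/
noncomputable def M (c : k) : GrWeyl k :=
  GrMod.quot (Weyl.z k + algebraMap k (Weyl k) c) 0 (Weyl.z_add_mem k c)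

end GrWeyl

end Weyl

/-- `{P, Q} ≅ {P', Q'}`: equality of two unordered pairs of objects, up to isomorphism. -/
def PairIso {C : Type*} [Category C] (P Q P' Q' : C) : Prop :=
  (Nonempty (P ≅ P') ∧ Nonempty (Q ≅ Q')) ∨ (Nonempty (P ≅ Q') ∧ Nonempty (Q ≅ P'))

/-!
On a graded right `A`-module the operator `ζ` = (right multiplication by `z`) - (degree) commutes
with `x` and `y`, hence is a natural endomorphism of the identity functor. It acts on `X⟨n⟩` and `Y⟨n⟩`
as `-n` and on `M_c` as `-c`. Since `xy` and `yx` act in degree `i` as `ζ + i` and `ζ + i - 1`, the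
simple modules on which `ζ` acts as a scalar `s` are easily listed: if `s` is not an integer the only
one is `M_{-s}`, and if `s = -n` there are exactly two, `X⟨n⟩` and `Y⟨n⟩`
(`GrWeyl.nonempty_iso_M_of_simple`, `GrWeyl.nonempty_iso_X_or_Y_of_simple`).

A natural endomorphism of the identity is determined by its values on the generators of the free
modules `A⟨i⟩`, which lie in `A_0 = k[z]`; it is therefore a polynomial in `ζ`
(`GrWeyl.exists_polynomial`). Transporting `ζ` along the autoequivalence `F` shows that there is a
polynomial `p` such that `F` turns the scalar `s` into `p(s)`
(`GrWeyl.exists_polynomial_hasScalar_obj`). The inverse of `F` gives a compositional inverse of `p`,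
so `p` has degree one. Both polynomials preserve the integers, the scalars for which there are two
simple modules, and this leaves only `p(s) = ±s - b` (`GrWeyl.exists_eval_eq_of_inverse`). The
classification of the simple modules then identifies the images of `X⟨n⟩`, `Y⟨n⟩` and `M_c`, and
the scalars on the images of `X⟨0⟩` and `X⟨1⟩` determine `a` and `b`.
-/

/-! ### Homogeneous elements of the Weyl algebra -/

namespace Weyl

open Polynomial

variable {k : Type u} [Field k]

theorem y_mul_x : y k * x k = z k - 1 := by
  rw [z, x_mul_y, add_sub_cancel_right]

theorem x_mul_z : x k * z k = (z k + 1) * x k := by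
  have h : x k * z k = x k * (y k * x k + 1) := by rw [z, x_mul_y]
  rw [h, mul_add, add_mul, z, mul_one, one_mul, mul_assoc]

theorem y_mul_z : y k * z k = (z k - 1) * y k := by
  rw [← y_mul_x, z, mul_assoc]

theorem gen_mul_z (g : WeylGen) : gen k g * z k = (z k + (g.deg : Weyl k)) * gen k g := by
  cases g
  · have h := x_mul_z (k := k)
    simpa [WeylGen.deg, x] using h
  · have h := y_mul_z (k := k)
    simpa [WeylGen.deg, y, sub_eq_add_neg] using h

/-- Commutation with `z` detects the degree: `rz = (z + n)r` for `r ∈ A_n`. -/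
theorem mul_z_of_mem {n : ℤ} {r : Weyl k} (hr : r ∈ grading k n) :
    r * z k = (z k + (n : Weyl k)) * r := by
  unfold grading at hr
  induction hr using Submodule.span_induction with
  | mem a h =>
    obtain ⟨w, rfl, rfl⟩ := h
    induction w with
    | nil => simp
    | cons g w ih =>
      have hc : gen k g * ((w.map WeylGen.deg).sum : Weyl k) =
          ((w.map WeylGen.deg).sum : Weyl k) * gen k g := (Int.cast_commute _ _).symm
      simp only [List.map_cons, List.prod_cons, List.sum_cons, Int.cast_add]
      rw [mul_assoc, ih, ← mul_assoc, mul_add, gen_mul_z, hc, ← add_mul, ← mul_assoc, add_assoc]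
  | zero => simp
  | add a b _ _ iha ihb => rw [add_mul, iha, ihb, mul_add]
  | smul c a _ iha => rw [smul_mul_assoc, iha, mul_smul_comm]

theorem exists_gen_mul_aeval (g : WeylGen) (p : k[X]) :
    ∃ q : k[X], gen k g * aeval (z k) p = aeval (z k) q * gen k g := by
  induction p using Polynomial.induction_on with
  | C c => exact ⟨C c, by rw [aeval_C, Algebra.commutes]⟩
  | add p p' h h' =>
    obtain ⟨q, hq⟩ := h
    obtain ⟨q', hq'⟩ := h'
    exact ⟨q + q', by rw [map_add, map_add, mul_add, add_mul, hq, hq']⟩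
  | monomial n c h =>
    obtain ⟨q, hq⟩ := h
    refine ⟨q * (X + C (g.deg : k)), ?_⟩
    have h1 : C c * X ^ (n + 1) = C c * X ^ n * X := by ring
    rw [h1, map_mul, ← mul_assoc, hq, map_mul, aeval_X, mul_assoc, gen_mul_z, map_add, aeval_X,
      aeval_C, map_intCast, mul_assoc]

/-- The monomial `x^n` for `n ≥ 0` and `y^{-n}` for `n ≤ 0`, which generates `A_n` over `k[z]`. -/
noncomputable def mon (n : ℤ) : Weyl k := x k ^ n.toNat * y k ^ (-n).toNat

theorem mon_natCast (j : ℕ) : mon (j : ℤ) = x k ^ j := by simp [mon]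

theorem mon_neg_natCast (j : ℕ) : mon (-(j : ℤ)) = y k ^ j := by simp [mon]

theorem exists_gen_mul_mon (g : WeylGen) (n : ℤ) :
    ∃ q : k[X], gen k g * mon n = aeval (z k) q * mon (g.deg + n) := by
  obtain ⟨j, rfl | rfl⟩ := n.eq_nat_or_neg
  · rw [mon_natCast]
    cases g
    · refine ⟨1, ?_⟩
      have h : WeylGen.x.deg + (j : ℤ) = ((j + 1 : ℕ) : ℤ) := by simp [WeylGen.deg]; ring
      rw [h, mon_natCast, map_one, one_mul, pow_succ', x]
    · cases j with
      | zero =>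
        refine ⟨1, ?_⟩
        have h : WeylGen.y.deg + ((0 : ℕ) : ℤ) = -((1 : ℕ) : ℤ) := by simp [WeylGen.deg]
        rw [h, mon_neg_natCast, map_one, one_mul, pow_zero, mul_one, pow_one, y]
      | succ j =>
        refine ⟨X - 1, ?_⟩
        have h : WeylGen.y.deg + ((j + 1 : ℕ) : ℤ) = (j : ℤ) := by simp [WeylGen.deg]
        rw [h, mon_natCast, pow_succ', ← mul_assoc, map_sub, aeval_X, map_one, ← y_mul_x, y]
  · rw [mon_neg_natCast]
    cases g
    · cases j with
      | zero =>
        refine ⟨1, ?_⟩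
        have h : WeylGen.x.deg + -((0 : ℕ) : ℤ) = ((1 : ℕ) : ℤ) := by simp [WeylGen.deg]
        rw [h, mon_natCast, map_one, one_mul, pow_zero, mul_one, pow_one, x]
      | succ j =>
        refine ⟨X, ?_⟩
        have h : WeylGen.x.deg + -((j + 1 : ℕ) : ℤ) = -(j : ℤ) := by simp [WeylGen.deg]
        rw [h, mon_neg_natCast, pow_succ', ← mul_assoc, aeval_X, z, x]
    · refine ⟨1, ?_⟩
      have h : WeylGen.y.deg + -(j : ℤ) = -((j + 1 : ℕ) : ℤ) := by simp [WeylGen.deg]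
      rw [h, mon_neg_natCast, map_one, one_mul, pow_succ', y]

/-- `A_n` is the rank one `k[z]`-module on the monomial of degree `n`. -/
theorem exists_eq_aeval_mul_mon {n : ℤ} {r : Weyl k} (hr : r ∈ grading k n) :
    ∃ p : k[X], r = aeval (z k) p * mon n := by
  unfold grading at hr
  induction hr using Submodule.span_induction with
  | mem a h =>
    obtain ⟨w, rfl, rfl⟩ := h
    induction w with
    | nil => exact ⟨1, by simp [mon]⟩
    | cons g w ih =>
      obtain ⟨p, hp⟩ := ih
      obtain ⟨q, hq⟩ := exists_gen_mul_aeval g p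
      obtain ⟨q', hq'⟩ := exists_gen_mul_mon (k := k) g (w.map WeylGen.deg).sum
      refine ⟨q * q', ?_⟩
      simp only [List.map_cons, List.prod_cons, List.sum_cons]
      rw [hp, ← mul_assoc, hq, mul_assoc, hq', map_mul, mul_assoc]
  | zero => exact ⟨0, by simp⟩
  | add a b _ _ iha ihb =>
    obtain ⟨p, hp⟩ := iha
    obtain ⟨q, hq⟩ := ihb
    exact ⟨p + q, by rw [map_add, add_mul, hp, hq]⟩
  | smul c a _ iha =>
    obtain ⟨p, hp⟩ := iha
    exact ⟨c • p, by rw [map_smul, smul_mul_assoc, hp]⟩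

theorem exists_eq_aeval {r : Weyl k} (hr : r ∈ grading k 0) : ∃ p : k[X], r = aeval (z k) p := by
  obtain ⟨p, hp⟩ := exists_eq_aeval_mul_mon hr
  exact ⟨p, by simpa [mon] using hp⟩

theorem x_pow_mem (j : ℕ) : x k ^ j ∈ grading k j := by
  have h := SetLike.pow_mem_graded j (x_mem k)
  rwa [nsmul_one] at h

theorem y_pow_mem (j : ℕ) : y k ^ j ∈ grading k (-(j : ℤ)) := by
  have h := SetLike.pow_mem_graded j (y_mem k)
  rwa [nsmul_eq_mul, mul_neg_one] at h

/-! ### Proper right ideals -/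

/-- Right multiplication by the generators on the functions `ℤ → k`, given by two weights `p`, `q`:
`(f x)(j) = p(j-1) f(j-1)` and `(f y)(j) = q(j) f(j+1)`. -/
def weightAction (p q : ℤ → k) : WeylGen → (Module.End k (ℤ → k))ᵐᵒᵖ
  | .x => MulOpposite.op
      { toFun := fun f j => p (j - 1) * f (j - 1)
        map_add' := fun f g => by ext j; simp [mul_add]
        map_smul' := fun c f => by ext j; simp; ring }
  | .y => MulOpposite.op
      { toFun := fun f j => q j * f (j + 1)
        map_add' := fun f g => by ext j; simp [mul_add]
        map_smul' := fun c f => by ext j; simp; ring }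

theorem weightAction_rel {p q : ℤ → k} {s : k} (h : ∀ j : ℤ, p j * q j = s + j) :
    weightAction p q .x * weightAction p q .y = weightAction p q .y * weightAction p q .x + 1 := by
  apply MulOpposite.unop_injective
  refine LinearMap.ext fun f => funext fun j => ?_
  simp only [weightAction, MulOpposite.unop_mul, MulOpposite.unop_op, Module.End.mul_apply,
    MulOpposite.unop_add, MulOpposite.unop_one, LinearMap.add_apply, Module.End.one_apply,
    LinearMap.coe_mk, AddHom.coe_mk, Pi.add_apply, add_sub_cancel_right, sub_add_cancel]
  have h1 := h j
  have h2 := h (j - 1)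
  push_cast at h2
  linear_combination f j * h1 - f j * h2

/-- An element that kills a nonzero vector of some right module generates a proper right ideal. -/
theorem one_notMem_rightIdeal {V : Type*} [AddCommGroup V] [Module k V]
    (φ : Weyl k →ₐ[k] (Module.End k V)ᵐᵒᵖ) {a : Weyl k} {v : V} (hv : v ≠ 0)
    (ha : (φ a).unop v = 0) : (1 : Weyl k) ∉ GrMod.rightIdeal a := by
  intro h
  obtain ⟨s, hs⟩ := GrMod.mem_rightIdeal.1 h
  apply hv
  have h1 := congrArg (fun t => (φ t).unop v) hs
  simp only [map_mul, map_one, MulOpposite.unop_mul, Module.End.mul_apply, ha, map_zero,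
    MulOpposite.unop_one, Module.End.one_apply] at h1
  exact h1.symm

theorem one_notMem_rightIdeal_x : (1 : Weyl k) ∉ GrMod.rightIdeal (x k) := by
  let p : ℤ → k := fun j => j
  let q : ℤ → k := fun _ => 1
  have h : ∀ j, p j * q j = 0 + j := fun j => by simp [p, q]
  refine one_notMem_rightIdeal (lift k (weightAction p q) (weightAction_rel h))
    (v := Pi.single 0 1) (by simp) ?_
  rw [x, lift_gen]
  funext j
  by_cases hj : j = 1
  · simp [weightAction, p, hj]
  · have hj' : j - 1 ≠ 0 := by omega
    simp [weightAction, p, hj']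

theorem one_notMem_rightIdeal_y : (1 : Weyl k) ∉ GrMod.rightIdeal (y k) := by
  let p : ℤ → k := fun _ => 1
  let q : ℤ → k := fun j => j
  have h : ∀ j, p j * q j = 0 + j := fun j => by simp [p, q]
  refine one_notMem_rightIdeal (lift k (weightAction p q) (weightAction_rel h))
    (v := Pi.single 1 1) (by simp) ?_
  rw [y, lift_gen]
  funext j
  by_cases hj : j = 0
  · simp [weightAction, q, hj]
  · have hj' : j + 1 ≠ 1 := by omega
    simp [weightAction, q, hj]

theorem one_notMem_rightIdeal_z_add (c : k) :
    (1 : Weyl k) ∉ GrMod.rightIdeal (z k + algebraMap k (Weyl k) c) := by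
  let p : ℤ → k := fun _ => 1
  let q : ℤ → k := fun j => -c + j
  have h : ∀ j, p j * q j = -c + j := fun j => by simp [p, q]
  refine one_notMem_rightIdeal (lift k (weightAction p q) (weightAction_rel h))
    (v := Pi.single 0 1) (by simp) ?_
  rw [z, map_add, map_mul, x, y, lift_gen, lift_gen, AlgHom.commutes,
    Algebra.algebraMap_eq_smul_one]
  funext j
  by_cases hj : j = 0 <;> simp [weightAction, p, q, hj]

end Weyl

/-! ### Graded modules and their morphisms -/

namespace GrMod

variable {k : Type u} [Field k] {R : Type u} [Ring R] [Algebra k R] {𝒜 : ℤ → Submodule k R}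

theorem op_smul_base (M : GrMod 𝒜) (c : k) (r : R) (m : M.carrier) :
    MulOpposite.op (c • r) • m = c • MulOpposite.op r • m := by
  rw [MulOpposite.op_smul, smul_assoc]

theorem op_smul_comm (M : GrMod 𝒜) (c : k) (r : R) (m : M.carrier) :
    MulOpposite.op r • c • m = c • MulOpposite.op r • m := by
  rw [← algebraMap_smul Rᵐᵒᵖ c m, ← algebraMap_smul Rᵐᵒᵖ c (MulOpposite.op r • m), ← mul_smul,
    ← mul_smul, Algebra.commutes]

theorem op_mul_smul (M : GrMod 𝒜) (r s : R) (m : M.carrier) :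
    MulOpposite.op (r * s) • m = MulOpposite.op s • MulOpposite.op r • m := by
  rw [MulOpposite.op_mul, mul_smul]

theorem op_algebraMap_smul (M : GrMod 𝒜) (c : k) (m : M.carrier) :
    MulOpposite.op (algebraMap k R c) • m = c • m := by
  rw [Algebra.algebraMap_eq_smul_one, op_smul_base, MulOpposite.op_one, one_smul]

theorem hom_smul {M N : GrMod 𝒜} (f : M ⟶ N) (c : k) (m : M.carrier) :
    f.1 (c • m) = c • f.1 m := by
  rw [← algebraMap_smul Rᵐᵒᵖ c m, map_smul, algebraMap_smul]

theorem hom_op_smul {M N : GrMod 𝒜} (f : M ⟶ N) (r : R) (m : M.carrier) :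
    f.1 (MulOpposite.op r • m) = MulOpposite.op r • f.1 m :=
  map_smul f.1 _ m

/-- A property of elements that is stable under sums holds everywhere once it holds on
homogeneous elements. -/
theorem homogeneous_induction (M : GrMod 𝒜) {P : M.carrier → Prop} (h0 : P 0)
    (ha : ∀ a b, P a → P b → P (a + b)) (hh : ∀ i, ∀ m ∈ M.comp i, P m) (m : M.carrier) : P m := by
  have h : m ∈ ⨆ i, M.comp i := by
    rw [M.isInternal.submodule_iSup_eq_top]; trivial
  exact Submodule.iSup_induction M.comp (motive := P) h hh h0 ha

theorem hom_ext_homogeneous {M N : GrMod 𝒜} {f g : M ⟶ N}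
    (h : ∀ i, ∀ m ∈ M.comp i, f.1 m = g.1 m) : f = g := by
  refine Subtype.ext (LinearMap.ext fun m => ?_)
  refine M.homogeneous_induction (P := fun m => f.1 m = g.1 m) ?_ ?_ h m
  · rw [map_zero, map_zero]
  · intro a b ha hb
    rw [map_add, map_add, ha, hb]

theorem exists_homogeneous_ne_zero_of_id_ne_zero (M : GrMod 𝒜) (h : 𝟙 M ≠ 0) :
    ∃ i, ∃ m ∈ M.comp i, m ≠ 0 := by
  by_contra! h'
  exact h (hom_ext_homogeneous fun i m hm => h' i m hm)

/-- The identification of a graded module with the direct sum of its components. -/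
noncomputable def decomp (M : GrMod 𝒜) : (⨁ i, M.comp i) ≃ₗ[k] M.carrier :=
  LinearEquiv.ofBijective (DirectSum.coeLinearMap M.comp) M.isInternal

theorem decomp_symm_of_mem (M : GrMod 𝒜) {i : ℤ} {m : M.carrier} (hm : m ∈ M.comp i) :
    M.decomp.symm m = DirectSum.lof k ℤ (fun i => M.comp i) i ⟨m, hm⟩ := by
  rw [LinearEquiv.symm_apply_eq]
  exact (DirectSum.coeLinearMap_lof M.comp i ⟨m, hm⟩).symm

/-- The projection of a graded module onto its component of degree `i`. -/
noncomputable def proj (M : GrMod 𝒜) (i : ℤ) : M.carrier →ₗ[k] M.carrier :=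
  (M.comp i).subtype ∘ₗ DirectSum.component k ℤ (fun i => M.comp i) i ∘ₗ M.decomp.symm.toLinearMap

theorem proj_mem (M : GrMod 𝒜) (i : ℤ) (m : M.carrier) : M.proj i m ∈ M.comp i :=
  (DirectSum.component k ℤ (fun i => M.comp i) i (M.decomp.symm m)).2

theorem proj_of_mem (M : GrMod 𝒜) {i : ℤ} {m : M.carrier} (hm : m ∈ M.comp i) :
    M.proj i m = m := by
  simp only [proj, LinearMap.comp_apply, LinearEquiv.coe_coe, M.decomp_symm_of_mem hm,
    DirectSum.component.lof_self, Submodule.subtype_apply]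

theorem proj_of_mem_ne (M : GrMod 𝒜) {i j : ℤ} (hij : j ≠ i) {m : M.carrier}
    (hm : m ∈ M.comp j) : M.proj i m = 0 := by
  simp only [proj, LinearMap.comp_apply, LinearEquiv.coe_coe, M.decomp_symm_of_mem hm,
    DirectSum.component.of, dif_neg hij, Submodule.subtype_apply, Submodule.coe_zero]

theorem eq_zero_of_proj (M : GrMod 𝒜) {m : M.carrier} (h : ∀ i, M.proj i m = 0) : m = 0 := by
  have h1 : M.decomp.symm m = 0 := DFinsupp.ext fun i => Subtype.ext (h i)
  rw [← M.decomp.apply_symm_apply m, h1, map_zero]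

theorem hom_proj {M N : GrMod 𝒜} (f : M ⟶ N) (i : ℤ) (m : M.carrier) :
    f.1 (M.proj i m) = N.proj i (f.1 m) := by
  refine M.homogeneous_induction (P := fun m => f.1 (M.proj i m) = N.proj i (f.1 m)) ?_ ?_ ?_ m
  · simp only [map_zero]
  · intro a b ha hb
    simp only [map_add, ha, hb]
  · intro j m hm
    by_cases hij : j = i
    · subst hij
      rw [M.proj_of_mem hm, N.proj_of_mem (f.2 _ _ hm)]
    · rw [M.proj_of_mem_ne hij hm, N.proj_of_mem_ne hij (f.2 _ _ hm), map_zero]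

/-- A degree preserving map is injective as soon as it is injective on each component. -/
theorem injective_of_homogeneous {M N : GrMod 𝒜} (f : M ⟶ N)
    (h : ∀ i, ∀ m ∈ M.comp i, f.1 m = 0 → m = 0) : Function.Injective f.1 := by
  refine (injective_iff_map_eq_zero f.1).2 fun m hm => M.eq_zero_of_proj fun i =>
    h i _ (M.proj_mem i m) ?_
  rw [hom_proj, hm, map_zero]

theorem mono_of_injective {M N : GrMod 𝒜} (f : M ⟶ N) (h : Function.Injective f.1) : Mono f :=
  ⟨fun _ _ hg => Subtype.ext (LinearMap.ext fun m =>
    h (congrArg (fun φ => φ.1 m) hg))⟩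

theorem isIso_of_bijective {M N : GrMod 𝒜} (f : M ⟶ N) (h : Function.Bijective f.1) :
    IsIso f := by
  let e := LinearEquiv.ofBijective f.1 h
  refine ⟨⟨e.symm.toLinearMap, fun i n hn => ?_⟩, ?_, ?_⟩
  · have h1 : f.1 (e.symm n) = n := e.apply_symm_apply n
    have h2 : M.proj i (e.symm n) = e.symm n := h.1 (by rw [hom_proj, h1, N.proj_of_mem hn])
    have h3 := M.proj_mem i (e.symm n)
    rwa [h2] at h3
  · exact Subtype.ext (LinearMap.ext fun m => e.symm_apply_apply m)
  · exact Subtype.ext (LinearMap.ext fun m => e.apply_symm_apply m)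

theorem iso_inv_hom_apply {M N : GrMod 𝒜} (e : M ≅ N) (n : N.carrier) :
    e.hom.1 (e.inv.1 n) = n :=
  congrArg (fun φ => φ.1 n) e.inv_hom_id

theorem iso_hom_inv_apply {M N : GrMod 𝒜} (e : M ≅ N) (m : M.carrier) :
    e.inv.1 (e.hom.1 m) = m :=
  congrArg (fun φ => φ.1 m) e.hom_inv_id

/-- The orbit map `r ↦ m r` of an element of a right module. -/
def orbit (M : GrMod 𝒜) (m : M.carrier) : R →ₗ[Rᵐᵒᵖ] M.carrier where
  toFun r := MulOpposite.op r • m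
  map_add' r s := by rw [MulOpposite.op_add, add_smul]
  map_smul' a r := by
    rw [RingHom.id_apply, ← mul_smul]
    rfl

theorem orbit_mem (M : GrMod 𝒜) {i j : ℤ} {m : M.carrier} (hm : m ∈ M.comp i) {r : R}
    (hr : r ∈ 𝒜 (j - i)) : M.orbit m r ∈ M.comp j := by
  have h := M.smul_mem i (j - i) m r hm hr
  rwa [add_sub_cancel] at h

/-- The map `R/aR → M` that sends `1` to an element killed by `a`. -/
def quotOrbit (M : GrMod 𝒜) {a : R} {m : M.carrier} (ha : MulOpposite.op a • m = 0) :
    (R ⧸ rightIdeal a) →ₗ[Rᵐᵒᵖ] M.carrier :=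
  (rightIdeal a).liftQ (M.orbit m) (by
    rw [rightIdeal, Submodule.span_le]
    rintro _ rfl
    exact ha)

theorem quotOrbit_mem (M : GrMod 𝒜) {a : R} {i j : ℤ} {m : M.carrier}
    (ha : MulOpposite.op a • m = 0) (hm : m ∈ M.comp i) {t : R ⧸ rightIdeal a}
    (ht : t ∈ quotComp 𝒜 a (j - i)) : M.quotOrbit ha t ∈ M.comp j := by
  obtain ⟨r, hr, rfl⟩ := ht
  exact M.orbit_mem hm hr

theorem quotOrbit_ne_zero (M : GrMod 𝒜) {a : R} {m : M.carrier}
    (ha : MulOpposite.op a • m = 0) (hm : m ≠ 0) : M.quotOrbit ha ≠ 0 := by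
  intro h
  apply hm
  have h1 := LinearMap.congr_fun h ((rightIdeal a).mkQ 1)
  change MulOpposite.op (1 : R) • m = 0 at h1
  rwa [MulOpposite.op_one, one_smul] at h1

section Free

variable [GradedAlgebra 𝒜]

variable (𝒜) in
/-- The free module of rank one `R⟨i⟩`, with its generator `1` in degree `i`. -/
def free (i : ℤ) : GrMod 𝒜 :=
  shift
    { carrier := R
      comp := 𝒜
      isInternal := DirectSum.Decomposition.isInternal 𝒜
      smul_mem := fun _ _ _ _ hm hr => SetLike.mul_mem_graded hm hr } i

theorem one_mem_free (i : ℤ) : (1 : R) ∈ (free 𝒜 i).comp i := by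
  change (1 : R) ∈ 𝒜 (i - i)
  rw [sub_self]
  exact SetLike.GradedOne.one_mem

/-- The map `R⟨i⟩ → M` that sends `1` to a given element of `M_i`. -/
def freeHom (M : GrMod 𝒜) {i : ℤ} {m : M.carrier} (hm : m ∈ M.comp i) : free 𝒜 i ⟶ M :=
  ⟨M.orbit m, fun _ _ hr => M.orbit_mem hm hr⟩

theorem freeHom_one (M : GrMod 𝒜) {i : ℤ} {m : M.carrier} (hm : m ∈ M.comp i) :
    (M.freeHom hm).1 (1 : R) = m := by
  change MulOpposite.op (1 : R) • m = m
  rw [MulOpposite.op_one, one_smul]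

/-- Monomorphisms are injective, since the free modules `R⟨i⟩` represent the components. -/
theorem injective_of_mono {M N : GrMod 𝒜} (f : M ⟶ N) [Mono f] : Function.Injective f.1 := by
  refine injective_of_homogeneous f fun i m hm hfm => ?_
  have h : M.freeHom hm ≫ f = M.freeHom (M.comp i).zero_mem ≫ f := by
    refine Subtype.ext (LinearMap.ext fun (r : R) => ?_)
    change f.1 (MulOpposite.op r • m) = f.1 (MulOpposite.op r • 0)
    rw [hom_op_smul, hfm, hom_op_smul, map_zero]
  have h1 := (cancel_mono f).1 h
  rw [← M.freeHom_one hm, h1, freeHom_one]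

end Free

/-! ### Simple graded modules -/

/-- Simplicity in terms of elements: the module has a nonzero generator, and every nonzero
homogeneous element has this generator as a multiple. -/
def IsGrSimple (M : GrMod 𝒜) : Prop :=
  ∃ g : M.carrier, g ≠ 0 ∧ (∀ t, ∃ r : R, MulOpposite.op r • g = t) ∧
    ∀ i, ∀ m ∈ M.comp i, m ≠ 0 → ∃ r : R, MulOpposite.op r • m = g

theorem IsGrSimple.shift {M : GrMod 𝒜} (h : M.IsGrSimple) (n : ℤ) : (M.shift n).IsGrSimple := by
  obtain ⟨g, h0, h1, h2⟩ := h
  exact ⟨g, h0, h1, fun i m hm => h2 (i - n) m hm⟩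

/-- A nonzero morphism out of a simple graded module is injective. -/
theorem IsGrSimple.injective {M N : GrMod 𝒜} (h : M.IsGrSimple) {f : M ⟶ N} (hf : f ≠ 0) :
    Function.Injective f.1 := by
  obtain ⟨g, h0, h1, h2⟩ := h
  refine injective_of_homogeneous f fun i m hm hfm => ?_
  by_contra hm0
  obtain ⟨r, rfl⟩ := h2 i m hm hm0
  refine hf (Subtype.ext (LinearMap.ext fun t => ?_))
  obtain ⟨s, rfl⟩ := h1 t
  rw [hom_op_smul, hom_op_smul, hfm, smul_zero, smul_zero]
  rfl

theorem IsGrSimple.simple [GradedAlgebra 𝒜] {M : GrMod 𝒜} (h : M.IsGrSimple) : Simple M := by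
  refine ⟨fun {N} f _ => ⟨fun hf h0 => ?_, fun hf => ?_⟩⟩
  · obtain ⟨g, hg, -, -⟩ := h
    apply hg
    subst h0
    have h1 := congrArg (fun φ => φ.1 g) (IsIso.inv_hom_id (0 : N ⟶ M))
    rw [Limits.comp_zero] at h1
    exact h1.symm
  · refine isIso_of_bijective f ⟨injective_of_mono f, fun t => ?_⟩
    obtain ⟨g, -, h1, h2⟩ := h
    have h3 : ∃ i, ∃ m ∈ N.comp i, f.1 m ≠ 0 := by
      by_contra! h'
      exact hf (hom_ext_homogeneous h')
    obtain ⟨i, m, hm, hfm⟩ := h3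
    obtain ⟨r, hr⟩ := h2 i _ (f.2 i m hm) hfm
    obtain ⟨s, hs⟩ := h1 t
    exact ⟨MulOpposite.op s • MulOpposite.op r • m, by rw [hom_op_smul, hom_op_smul, hr, hs]⟩

/-- Schur's lemma for a simple source given by elements and a categorically simple target. -/
theorem IsGrSimple.nonempty_iso {M N : GrMod 𝒜} (h : M.IsGrSimple) [Simple N] {f : M ⟶ N}
    (hf : f ≠ 0) : Nonempty (N ≅ M) := by
  have := mono_of_injective f (h.injective hf)
  have := isIso_of_mono_of_nonzero hf
  exact ⟨(asIso f).symm⟩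

end GrMod

/-! ### Graded modules on which `z` acts by a scalar shifted by the degree -/

namespace GrWeyl

open Polynomial

variable {k : Type u} [Field k]

/-- The module has central character `s`: on the component of degree `i` the element `z` acts as the
scalar `s + i`. Equivalently, the central operator "`z` minus the degree" acts as `s`. -/
def HasScalar (M : GrWeyl k) (s : k) : Prop :=
  ∀ i, ∀ m ∈ M.comp i, MulOpposite.op (Weyl.z k) • m = (s + (i : k)) • m

namespace HasScalar

variable {M N : GrWeyl k} {s t : k}

theorem shift (h : HasScalar M s) (n : ℤ) : HasScalar (M.shift n) (s - n) := by
  intro i m hm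
  have h1 := h (i - n) m hm
  rw [Int.cast_sub] at h1
  rw [show s - (n : k) + (i : k) = s + ((i : k) - (n : k)) by ring]
  exact h1

theorem of_iso (e : M ≅ N) (h : HasScalar M s) : HasScalar N s := by
  intro i n hn
  rw [← GrMod.iso_inv_hom_apply e n, ← GrMod.hom_op_smul, h i _ (e.inv.2 i n hn), GrMod.hom_smul]

theorem unique (h : HasScalar M s) (h' : HasScalar M t) {i : ℤ} {m : M.carrier}
    (hm : m ∈ M.comp i) (h0 : m ≠ 0) : s = t := by
  have h1 := (h i m hm).symm.trans (h' i m hm)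
  exact add_right_cancel (smul_left_injective k h0 h1)

theorem y_smul_x_smul (h : HasScalar M s) {i : ℤ} {m : M.carrier} (hm : m ∈ M.comp i) :
    MulOpposite.op (Weyl.y k) • MulOpposite.op (Weyl.x k) • m = (s + (i : k)) • m := by
  rw [← GrMod.op_mul_smul]
  exact h i m hm

theorem x_smul_y_smul (h : HasScalar M s) {i : ℤ} {m : M.carrier} (hm : m ∈ M.comp i) :
    MulOpposite.op (Weyl.x k) • MulOpposite.op (Weyl.y k) • m = (s + (i : k) - 1) • m := by
  rw [← GrMod.op_mul_smul, Weyl.y_mul_x, MulOpposite.op_sub, sub_smul, h i m hm,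
    MulOpposite.op_one, one_smul, sub_smul, one_smul]

end HasScalar

theorem x_smul_mem {M : GrWeyl k} {i : ℤ} {m : M.carrier} (hm : m ∈ M.comp i) :
    MulOpposite.op (Weyl.x k) • m ∈ M.comp (i + 1) :=
  M.smul_mem i 1 m _ hm (Weyl.x_mem k)

theorem y_smul_mem {M : GrWeyl k} {i : ℤ} {m : M.carrier} (hm : m ∈ M.comp i) :
    MulOpposite.op (Weyl.y k) • m ∈ M.comp (i - 1) :=
  M.smul_mem i (-1) m _ hm (Weyl.y_mem k)

theorem x_pow_smul_mem {M : GrWeyl k} {i : ℤ} {m : M.carrier} (hm : m ∈ M.comp i) (n : ℕ) :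
    MulOpposite.op (Weyl.x k ^ n) • m ∈ M.comp (i + n) :=
  M.smul_mem i n m _ hm (Weyl.x_pow_mem n)

theorem y_pow_smul_mem {M : GrWeyl k} {i : ℤ} {m : M.carrier} (hm : m ∈ M.comp i) (n : ℕ) :
    MulOpposite.op (Weyl.y k ^ n) • m ∈ M.comp (i - n) :=
  M.smul_mem i (-n) m _ hm (Weyl.y_pow_mem n)

theorem aeval_smul {M : GrWeyl k} {m : M.carrier} {σ : k}
    (h : MulOpposite.op (Weyl.z k) • m = σ • m) (p : k[X]) :
    MulOpposite.op (aeval (Weyl.z k) p) • m = p.eval σ • m := by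
  induction p using Polynomial.induction_on with
  | C c => rw [aeval_C, GrMod.op_algebraMap_smul, eval_C]
  | add p q hp hq => rw [map_add, MulOpposite.op_add, add_smul, hp, hq, eval_add, add_smul]
  | monomial n c ih =>
    rw [pow_succ, ← mul_assoc, map_mul, GrMod.op_mul_smul, ih, aeval_X, GrMod.op_smul_comm, h,
      smul_smul, eval_mul_X]

/-- A weight vector can be recovered from its image under `x ^ n` as long as none of the
intermediate products `xy` vanishes. -/
theorem exists_smul_x_pow_smul {M : GrWeyl k} {s : k} (h : HasScalar M s) {i : ℤ} {m : M.carrier}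
    (hm : m ∈ M.comp i) (n : ℕ) (hn : ∀ j : ℕ, s + (i : k) + (j : k) ≠ 0) :
    ∃ r : Weyl k, MulOpposite.op r • MulOpposite.op (Weyl.x k ^ n) • m = m := by
  induction n with
  | zero => exact ⟨1, by simp⟩
  | succ n ih =>
    obtain ⟨r, hr⟩ := ih
    refine ⟨(s + (i : k) + (n : k))⁻¹ • (Weyl.y k * r), ?_⟩
    have h1 := h.y_smul_x_smul (x_pow_smul_mem hm n)
    rw [Int.cast_add, Int.cast_natCast, ← add_assoc] at h1
    rw [pow_succ, GrMod.op_mul_smul, GrMod.op_smul_base, GrMod.op_mul_smul, h1,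
      GrMod.op_smul_comm, hr, smul_smul, inv_mul_cancel₀ (hn n), one_smul]

theorem exists_smul_y_pow_smul {M : GrWeyl k} {s : k} (h : HasScalar M s) {i : ℤ} {m : M.carrier}
    (hm : m ∈ M.comp i) (n : ℕ) (hn : ∀ j : ℕ, s + (i : k) - 1 - (j : k) ≠ 0) :
    ∃ r : Weyl k, MulOpposite.op r • MulOpposite.op (Weyl.y k ^ n) • m = m := by
  induction n with
  | zero => exact ⟨1, by simp⟩
  | succ n ih =>
    obtain ⟨r, hr⟩ := ih
    refine ⟨(s + (i : k) - 1 - (n : k))⁻¹ • (Weyl.x k * r), ?_⟩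
    have h1 := h.x_smul_y_smul (y_pow_smul_mem hm n)
    rw [Int.cast_sub, Int.cast_natCast,
      show s + ((i : k) - (n : k)) - 1 = s + (i : k) - 1 - (n : k) by ring] at h1
    rw [pow_succ, GrMod.op_mul_smul, GrMod.op_smul_base, GrMod.op_mul_smul, h1,
      GrMod.op_smul_comm, hr, smul_smul, inv_mul_cancel₀ (hn n), one_smul]

/-! ### The modules `A/aA` -/

section Quotient

variable {a : Weyl k} {d : ℤ} {ha : a ∈ Weyl.grading k d}

variable (ha) in
/-- The class of `1` in `A/aA`. -/
noncomputable def quotGen : (GrMod.quot a d ha).carrier := (GrMod.rightIdeal a).mkQ 1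

theorem op_smul_quotGen (r : Weyl k) :
    MulOpposite.op r • quotGen ha = (GrMod.rightIdeal a).mkQ r := by
  rw [quotGen]
  change (GrMod.rightIdeal a).mkQ (MulOpposite.op r • 1) = _
  rw [op_smul_eq_mul, one_mul]

theorem op_smul_quotGen_eq_zero {r : Weyl k} (hr : r ∈ GrMod.rightIdeal a) :
    MulOpposite.op r • quotGen ha = 0 := by
  rw [op_smul_quotGen]
  exact (Submodule.Quotient.mk_eq_zero _).2 hr

theorem quotGen_mem : quotGen ha ∈ (GrMod.quot a d ha).comp 0 :=
  ⟨1, SetLike.GradedOne.one_mem, rfl⟩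

theorem quotGen_ne_zero (h1 : (1 : Weyl k) ∉ GrMod.rightIdeal a) : quotGen ha ≠ 0 :=
  fun h => h1 ((Submodule.Quotient.mk_eq_zero _).1 h)

theorem exists_eq_smul_quotGen {i : ℤ} {m : (GrMod.quot a d ha).carrier}
    (hm : m ∈ (GrMod.quot a d ha).comp i) :
    ∃ r ∈ Weyl.grading k i, m = MulOpposite.op r • quotGen ha := by
  obtain ⟨r, hr, rfl⟩ := hm
  exact ⟨r, hr, (op_smul_quotGen r).symm⟩

variable {s : k}

theorem hasScalar_quot (hs : MulOpposite.op (Weyl.z k) • quotGen ha = s • quotGen ha) :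
     HasScalar (GrMod.quot a d ha) s := by
  intro i m hm
  obtain ⟨r, hr, rfl⟩ := exists_eq_smul_quotGen hm
  rw [← GrMod.op_mul_smul, Weyl.mul_z_of_mem hr, GrMod.op_mul_smul, MulOpposite.op_add, add_smul,
    hs, ← map_intCast (algebraMap k (Weyl k)), GrMod.op_algebraMap_smul, ← add_smul,
    GrMod.op_smul_comm]

theorem exists_eq_smul_mon_quotGen
    (hs : MulOpposite.op (Weyl.z k) • quotGen ha = s • quotGen ha) {i : ℤ}
    {m : (GrMod.quot a d ha).carrier}
    (hm : m ∈ (GrMod.quot a d ha).comp i) :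
    ∃ c : k, m = c • MulOpposite.op (Weyl.mon (k := k) i) • quotGen ha := by
  obtain ⟨r, hr, rfl⟩ := exists_eq_smul_quotGen hm
  obtain ⟨p, rfl⟩ := Weyl.exists_eq_aeval_mul_mon hr
  exact ⟨p.eval s, by rw [GrMod.op_mul_smul, aeval_smul hs, GrMod.op_smul_comm]⟩

theorem isGrSimple_quot (hs : MulOpposite.op (Weyl.z k) • quotGen ha = s • quotGen ha)
    (h1 : (1 : Weyl k) ∉ GrMod.rightIdeal a)
    (hx : Weyl.x k ∈ GrMod.rightIdeal a ∨ ∀ j : ℕ, s + (j : k) ≠ 0)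
    (hy : Weyl.y k ∈ GrMod.rightIdeal a ∨ ∀ j : ℕ, s - 1 - (j : k) ≠ 0) :
    (GrMod.quot a d ha).IsGrSimple := by
  have hS := hasScalar_quot hs
  refine ⟨quotGen ha, quotGen_ne_zero h1, fun t => ?_, fun i m hm hm0 => ?_⟩
  · obtain ⟨r, rfl⟩ := (GrMod.rightIdeal a).mkQ_surjective t
    exact ⟨r, op_smul_quotGen r⟩
  · obtain ⟨c, rfl⟩ := exists_eq_smul_mon_quotGen hs hm
    have hc : c ≠ 0 := by
      rintro rfl
      exact hm0 (zero_smul _ _)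
    have hmon : MulOpposite.op (Weyl.mon (k := k) i) • quotGen ha ≠ 0 := by
      intro h
      exact hm0 (by rw [h, smul_zero])
    suffices h : ∃ r : Weyl k,
        MulOpposite.op r • MulOpposite.op (Weyl.mon (k := k) i) • quotGen ha = quotGen ha by
      obtain ⟨r, hr⟩ := h
      exact ⟨c⁻¹ • r, by
        rw [GrMod.op_smul_base, GrMod.op_smul_comm, hr, smul_smul, inv_mul_cancel₀ hc, one_smul]⟩
    obtain ⟨n, rfl | rfl⟩ := i.eq_nat_or_neg
    · rw [Weyl.mon_natCast] at hmon ⊢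
      rcases hx with hx | hx
      · cases n with
        | zero => exact ⟨1, by simp⟩
        | succ n =>
          rw [pow_succ', GrMod.op_mul_smul, op_smul_quotGen_eq_zero hx, smul_zero] at hmon
          exact absurd rfl hmon
      · exact exists_smul_x_pow_smul hS quotGen_mem n (by simpa using hx)
    · rw [Weyl.mon_neg_natCast] at hmon ⊢
      rcases hy with hy | hy
      · cases n with
        | zero => exact ⟨1, by simp⟩
        | succ n =>
          rw [pow_succ', GrMod.op_mul_smul, op_smul_quotGen_eq_zero hy, smul_zero] at hmon
          exact absurd rfl hmon
      · exact exists_smul_y_pow_smul hS quotGen_mem n (by simpa using hy)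

end Quotient

theorem z_smul_quotGen_x : MulOpposite.op (Weyl.z k) • quotGen (Weyl.x_mem k) =
    (0 : k) • quotGen (Weyl.x_mem k) := by
  have h : Weyl.z k ∈ GrMod.rightIdeal (Weyl.x k) := GrMod.mem_rightIdeal.2 ⟨Weyl.y k, rfl⟩
  rw [op_smul_quotGen_eq_zero h, zero_smul]

theorem z_smul_quotGen_y : MulOpposite.op (Weyl.z k) • quotGen (Weyl.y_mem k) =
    (1 : k) • quotGen (Weyl.y_mem k) := by
  have h := op_smul_quotGen_eq_zero (ha := Weyl.y_mem k)
    (GrMod.mem_rightIdeal.2 ⟨Weyl.x k, Weyl.y_mul_x⟩)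
  rw [MulOpposite.op_sub, sub_smul, MulOpposite.op_one, one_smul, sub_eq_zero] at h
  rw [h, one_smul]

theorem z_smul_quotGen_z (c : k) : MulOpposite.op (Weyl.z k) • quotGen (Weyl.z_add_mem k c) =
    (-c) • quotGen (Weyl.z_add_mem k c) := by
  have h := op_smul_quotGen_eq_zero (ha := Weyl.z_add_mem k c)
    (GrMod.mem_rightIdeal.2 ⟨1, mul_one _⟩)
  rw [MulOpposite.op_add, add_smul, GrMod.op_algebraMap_smul] at h
  rw [neg_smul]
  exact eq_neg_of_add_eq_zero_left h

theorem hasScalar_X_shift (n : ℤ) : HasScalar ((X k).shift n) (-n) := by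
  have h := (hasScalar_quot (z_smul_quotGen_x (k := k))).shift n
  rwa [zero_sub] at h

theorem hasScalar_Y_shift (n : ℤ) : HasScalar ((Y k).shift n) (-n) := by
  have h := ((hasScalar_quot (z_smul_quotGen_y (k := k))).shift 1).shift n
  rwa [Int.cast_one, sub_self, zero_sub] at h

theorem hasScalar_M (c : k) : HasScalar (M k c) (-c) :=
  hasScalar_quot (z_smul_quotGen_z c)

theorem isGrSimple_X_shift [CharZero k] (n : ℤ) : ((X k).shift n).IsGrSimple := by
  refine (isGrSimple_quot z_smul_quotGen_x Weyl.one_notMem_rightIdeal_x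
    (Or.inl (GrMod.mem_rightIdeal.2 ⟨1, mul_one _⟩)) (Or.inr fun j h => ?_)).shift n
  have h1 : ((j + 1 : ℕ) : k) = 0 := by
    push_cast
    linear_combination -h
  exact Nat.cast_ne_zero.2 j.succ_ne_zero h1

theorem isGrSimple_Y_shift [CharZero k] (n : ℤ) : ((Y k).shift n).IsGrSimple := by
  refine ((isGrSimple_quot z_smul_quotGen_y Weyl.one_notMem_rightIdeal_y
    (Or.inr fun j h => ?_) (Or.inl (GrMod.mem_rightIdeal.2 ⟨1, mul_one _⟩))).shift 1).shift n
  have h1 : ((j + 1 : ℕ) : k) = 0 := by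
    push_cast
    linear_combination h
  exact Nat.cast_ne_zero.2 j.succ_ne_zero h1

theorem isGrSimple_M {c : k} (hc : c ∉ Set.range (Int.cast : ℤ → k)) : (M k c).IsGrSimple := by
  refine isGrSimple_quot (z_smul_quotGen_z c) (Weyl.one_notMem_rightIdeal_z_add c)
    (Or.inr fun j h => hc ⟨j, ?_⟩) (Or.inr fun j h => hc ⟨-1 - j, ?_⟩)
  · push_cast
    linear_combination h
  · push_cast
    linear_combination h

/-- `X⟨n⟩` lives in degrees at most `n` and `Y⟨n⟩` in degrees greater than `n`. -/
theorem not_nonempty_X_shift_iso_Y_shift (n : ℤ) :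
    ¬ Nonempty ((X k).shift n ≅ (Y k).shift n) := by
  rintro ⟨e⟩
  have hg : quotGen (Weyl.x_mem k) ∈ ((X k).shift n).comp n := by
    change _ ∈ (GrMod.quot _ _ (Weyl.x_mem k)).comp (n - n)
    rw [sub_self]
    exact quotGen_mem
  have h1 : e.hom.1 (quotGen (Weyl.x_mem k)) ∈
      (GrMod.quot _ _ (Weyl.y_mem k)).comp (n - n - 1) := e.hom.2 n _ hg
  rw [sub_self, zero_sub] at h1
  obtain ⟨c, hc⟩ := exists_eq_smul_mon_quotGen z_smul_quotGen_y h1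
  have h2 : Weyl.mon (k := k) (-1) = Weyl.y k := by simp [Weyl.mon]
  rw [h2, op_smul_quotGen_eq_zero (GrMod.mem_rightIdeal.2 ⟨1, mul_one _⟩), smul_zero] at hc
  apply quotGen_ne_zero (ha := Weyl.x_mem k) Weyl.one_notMem_rightIdeal_x
  have h3 := GrMod.iso_hom_inv_apply e (quotGen (Weyl.x_mem k))
  rw [hc] at h3
  exact h3.symm.trans (map_zero e.inv.1)

/-! ### Classification of the simple modules with a central character -/

section Classification

variable {T : GrWeyl k}

theorem nonempty_iso_X_shift [CharZero k] [Simple T] {n : ℤ} {m : T.carrier} (hm : m ∈ T.comp n)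
    (h0 : m ≠ 0) (hx : MulOpposite.op (Weyl.x k) • m = 0) : Nonempty (T ≅ (X k).shift n) := by
  let f : (X k).shift n ⟶ T := ⟨T.quotOrbit hx, fun _ _ ht => T.quotOrbit_mem hx hm ht⟩
  exact (isGrSimple_X_shift n).nonempty_iso (f := f)
    fun h => T.quotOrbit_ne_zero hx h0 (congrArg Subtype.val h)

theorem nonempty_iso_Y_shift [CharZero k] [Simple T] {n : ℤ} {m : T.carrier}
    (hm : m ∈ T.comp (n + 1)) (h0 : m ≠ 0) (hy : MulOpposite.op (Weyl.y k) • m = 0) :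
    Nonempty (T ≅ (Y k).shift n) := by
  let f : (Y k).shift n ⟶ T := ⟨T.quotOrbit hy, fun j t ht => by
    have ht' : t ∈ GrMod.quotComp (Weyl.grading k) (Weyl.y k) (j - n - 1) := ht
    rw [sub_sub] at ht'
    exact T.quotOrbit_mem hy hm ht'⟩
  exact (isGrSimple_Y_shift n).nonempty_iso (f := f)
    fun h => T.quotOrbit_ne_zero hy h0 (congrArg Subtype.val h)

theorem nonempty_iso_M [Simple T] {c : k} (hc : c ∉ Set.range (Int.cast : ℤ → k)) {m : T.carrier}
    (hm : m ∈ T.comp 0) (h0 : m ≠ 0)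
    (hz : MulOpposite.op (Weyl.z k + algebraMap k (Weyl k) c) • m = 0) :
    Nonempty (T ≅ M k c) := by
  let f : M k c ⟶ T := ⟨T.quotOrbit hz, fun j t ht => by
    have ht' : t ∈ GrMod.quotComp (Weyl.grading k) (Weyl.z k + algebraMap k (Weyl k) c) j := ht
    rw [← sub_zero j] at ht'
    exact T.quotOrbit_mem hz hm ht'⟩
  exact (isGrSimple_M hc).nonempty_iso (f := f)
    fun h => T.quotOrbit_ne_zero hz h0 (congrArg Subtype.val h)

theorem HasScalar.x_smul_ne_zero {s : k} (h : HasScalar T s) {i : ℤ} {m : T.carrier}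
    (hm : m ∈ T.comp i) (h0 : m ≠ 0) (hs : s + (i : k) ≠ 0) :
    MulOpposite.op (Weyl.x k) • m ≠ 0 := by
  intro hx
  have h1 := h.y_smul_x_smul hm
  rw [hx, smul_zero] at h1
  exact smul_ne_zero hs h0 h1.symm

theorem HasScalar.y_smul_ne_zero {s : k} (h : HasScalar T s) {i : ℤ} {m : T.carrier}
    (hm : m ∈ T.comp i) (h0 : m ≠ 0) (hs : s + (i : k) - 1 ≠ 0) :
    MulOpposite.op (Weyl.y k) • m ≠ 0 := by
  intro hy
  have h1 := h.x_smul_y_smul hm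
  rw [hy, smul_zero] at h1
  exact smul_ne_zero hs h0 h1.symm

/-- Multiplication by `x` is injective on the component of degree `i` unless `s + i = 0`, so a nonzero
component forces the next ones to be nonzero until that degree is passed. -/
theorem HasScalar.exists_ne_zero_up {s : k} (h : HasScalar T s) {i : ℤ}
    (hi : ∃ m ∈ T.comp i, m ≠ 0) (n : ℕ) (hn : ∀ j : ℕ, j < n → s + ((i + j : ℤ) : k) ≠ 0) :
    ∃ m ∈ T.comp (i + n), m ≠ 0 := by
  induction n with
  | zero => simpa using hi
  | succ n ih =>
    obtain ⟨m, hm, h0⟩ := ih fun j hj => hn j (hj.trans n.lt_succ_self)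
    refine ⟨_, ?_, h.x_smul_ne_zero hm h0 (hn n n.lt_succ_self)⟩
    have h1 := x_smul_mem hm
    rwa [add_assoc, ← Nat.cast_succ] at h1

/-- Multiplication by `y` is injective on the component of degree `i` unless `s + i - 1 = 0`. -/
theorem HasScalar.exists_ne_zero_down {s : k} (h : HasScalar T s) {i : ℤ}
    (hi : ∃ m ∈ T.comp i, m ≠ 0) (n : ℕ) (hn : ∀ j : ℕ, j < n → s + ((i - j - 1 : ℤ) : k) ≠ 0) :
    ∃ m ∈ T.comp (i - n), m ≠ 0 := by
  induction n with
  | zero => simpa using hi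
  | succ n ih =>
    obtain ⟨m, hm, h0⟩ := ih fun j hj => hn j (hj.trans n.lt_succ_self)
    refine ⟨_, ?_, h.y_smul_ne_zero hm h0 ?_⟩
    · have h1 := y_smul_mem hm
      rwa [sub_sub, ← Nat.cast_succ] at h1
    · have h1 := hn n n.lt_succ_self
      rwa [Int.cast_sub (i - n), Int.cast_one, ← add_sub_assoc] at h1

/-- For a non-integral central character all the components are nonzero once one of them is. -/
theorem HasScalar.exists_ne_zero {s : k} (h : HasScalar T s)
    (hs : s ∉ Set.range (Int.cast : ℤ → k)) {i : ℤ} (hi : ∃ m ∈ T.comp i, m ≠ 0) (j : ℤ) :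
    ∃ m ∈ T.comp j, m ≠ 0 := by
  have hs' : ∀ l : ℤ, s + (l : k) ≠ 0 := fun l hl => hs ⟨-l, by
    push_cast
    linear_combination -hl⟩
  rcases le_total i j with hij | hij
  · obtain ⟨n, rfl⟩ := Int.le.dest hij
    exact h.exists_ne_zero_up hi n fun _ _ => hs' _
  · obtain ⟨n, hn⟩ := Int.le.dest hij
    obtain rfl : j = i - n := by omega
    exact h.exists_ne_zero_down hi n fun _ _ => hs' _

theorem exists_ne_zero_of_simple (T : GrWeyl k) [Simple T] : ∃ i, ∃ m ∈ T.comp i, m ≠ 0 :=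
  T.exists_homogeneous_ne_zero_of_id_ne_zero (id_nonzero T)

theorem nonempty_iso_M_of_simple [Simple T] {s : k} (h : HasScalar T s)
    (hs : s ∉ Set.range (Int.cast : ℤ → k)) : Nonempty (T ≅ M k (-s)) := by
  obtain ⟨i, hi⟩ := exists_ne_zero_of_simple T
  obtain ⟨m, hm, h0⟩ := h.exists_ne_zero hs hi 0
  refine nonempty_iso_M (fun ⟨l, hl⟩ => hs ⟨-l, by rw [Int.cast_neg, hl, neg_neg]⟩) hm h0 ?_
  rw [MulOpposite.op_add, add_smul, GrMod.op_algebraMap_smul, h 0 m hm, ← add_smul]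
  simp

theorem nonempty_iso_X_or_Y_of_simple [CharZero k] [Simple T] {n : ℤ}
    (h : HasScalar T (-(n : k))) :
    Nonempty (T ≅ (X k).shift n) ∨ Nonempty (T ≅ (Y k).shift n) := by
  have hne : ∀ l : ℤ, l ≠ n → -(n : k) + (l : k) ≠ 0 := fun l hl h' =>
    hl (Int.cast_injective (α := k) (by linear_combination h'))
  obtain ⟨i, hi⟩ := exists_ne_zero_of_simple T
  -- The only step between adjacent degrees that may vanish is the one between `n` and `n + 1`.
  rcases le_or_gt i n with hin | hin
  · obtain ⟨l, rfl⟩ := Int.le.dest hin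
    obtain ⟨m, hm, h0⟩ := h.exists_ne_zero_up hi l fun j hj => hne _ (by omega)
    by_cases hx : MulOpposite.op (Weyl.x k) • m = 0
    · exact Or.inl (nonempty_iso_X_shift hm h0 hx)
    · refine Or.inr (nonempty_iso_Y_shift (x_smul_mem hm) hx ?_)
      rw [h.y_smul_x_smul hm, neg_add_cancel, zero_smul]
  · obtain ⟨l, hl⟩ := Int.le.dest (Int.add_one_le_of_lt hin)
    obtain ⟨m, hm, h0⟩ := h.exists_ne_zero_down hi l fun j hj => hne _ (by omega)
    rw [show i - (l : ℤ) = n + 1 by omega] at hm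
    by_cases hy : MulOpposite.op (Weyl.y k) • m = 0
    · exact Or.inr (nonempty_iso_Y_shift hm h0 hy)
    · have hm' := y_smul_mem hm
      rw [add_sub_cancel_right] at hm'
      refine Or.inl (nonempty_iso_X_shift hm' hy ?_)
      rw [h.x_smul_y_smul hm, Int.cast_add, Int.cast_one,
        show -(n : k) + ((n : k) + 1) - 1 = 0 by ring, zero_smul]

end Classification

end GrWeyl

namespace GrWeyl

open Polynomial

variable {k : Type u} [Field k]

/-! ### The central operator and its transport along an equivalence -/

/-- The operator that multiplies the component of degree `i` by `i`. -/
noncomputable def degreeMap (M : GrWeyl k) : M.carrier →ₗ[k] M.carrier :=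
  DirectSum.toModule k ℤ M.carrier (fun i => (i : k) • (M.comp i).subtype) ∘ₗ
    M.decomp.symm.toLinearMap

theorem degreeMap_of_mem (M : GrWeyl k) {i : ℤ} {m : M.carrier} (hm : m ∈ M.comp i) :
    degreeMap M m = (i : k) • m := by
  simp only [degreeMap, LinearMap.comp_apply, LinearEquiv.coe_coe, M.decomp_symm_of_mem hm,
    DirectSum.toModule_lof, LinearMap.smul_apply, Submodule.subtype_apply]

/-- The central operator: right multiplication by `z` minus the degree. It is an endomorphism of
every graded module. -/
noncomputable def central (M : GrWeyl k) : M ⟶ M :=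
  ⟨{ toFun := fun m => MulOpposite.op (Weyl.z k) • m - degreeMap M m
     map_add' := fun a b => by rw [smul_add, map_add, add_sub_add_comm]
     map_smul' := fun r m => by
      obtain ⟨r, rfl⟩ := MulOpposite.op_surjective r
      rw [RingHom.id_apply]
      induction r using DirectSum.Decomposition.inductionOn (Weyl.grading k) with
      | zero => simp only [MulOpposite.op_zero, zero_smul, smul_zero, map_zero, sub_zero]
      | add a b ha hb =>
        simp only [MulOpposite.op_add, add_smul, smul_add, map_add, ← ha, ← hb, add_sub_add_comm]
      | @homogeneous j r =>
        obtain ⟨r, hr⟩ := r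
        refine M.homogeneous_induction (P := fun m =>
          MulOpposite.op (Weyl.z k) • MulOpposite.op r • m - degreeMap M (MulOpposite.op r • m) =
            MulOpposite.op r • (MulOpposite.op (Weyl.z k) • m - degreeMap M m)) ?_ ?_ ?_ m
        · simp only [smul_zero, map_zero, sub_zero]
        · intro a b ha hb
          simp only [smul_add, map_add, add_sub_add_comm, ha, hb]
        · intro i m hm
          rw [degreeMap_of_mem M hm, degreeMap_of_mem M (M.smul_mem i j m r hm hr),
            ← GrMod.op_mul_smul, Weyl.mul_z_of_mem hr, GrMod.op_mul_smul, MulOpposite.op_add,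
            add_smul, ← map_intCast (algebraMap k (Weyl k)), GrMod.op_algebraMap_smul, smul_add,
            smul_sub, GrMod.op_smul_comm, GrMod.op_smul_comm, Int.cast_add, add_smul]
          abel },
    fun i m hm => by
      have h1 := M.smul_mem i 0 m _ hm (by simpa using Weyl.z_add_mem k 0)
      rw [add_zero] at h1
      have h2 := (M.comp i).smul_mem (i : k) hm
      rw [← degreeMap_of_mem M hm] at h2
      exact (M.comp i).sub_mem h1 h2⟩

theorem central_of_mem (M : GrWeyl k) {i : ℤ} {m : M.carrier} (hm : m ∈ M.comp i) :
    (central M).1 m = MulOpposite.op (Weyl.z k) • m - (i : k) • m := by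
  rw [← degreeMap_of_mem M hm]
  rfl

theorem central_naturality {M N : GrWeyl k} (f : M ⟶ N) : f ≫ central N = central M ≫ f := by
  refine GrMod.hom_ext_homogeneous fun i m hm => ?_
  change (central N).1 (f.1 m) = f.1 ((central M).1 m)
  rw [central_of_mem M hm, central_of_mem N (f.2 i m hm), map_sub, GrMod.hom_op_smul,
    GrMod.hom_smul]

theorem hasScalar_iff_central {M : GrWeyl k} {s : k} : HasScalar M s ↔ central M = s • 𝟙 M := by
  constructor
  · intro h
    refine GrMod.hom_ext_homogeneous fun i m hm => ?_
    rw [central_of_mem M hm, h i m hm, add_smul, add_sub_cancel_right]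
    rfl
  · intro h i m hm
    have h1 := central_of_mem M hm
    rw [h] at h1
    rw [add_smul]
    exact (sub_eq_iff_eq_add.1 h1.symm)

section EndId

variable {η : ∀ M : GrWeyl k, M ⟶ M}

/-- On each degree, a natural endomorphism acts through a polynomial in `z`: its value on the
generator of `A⟨i⟩`. -/
theorem exists_polynomial_degree
    (hη : ∀ {M N : GrWeyl k} (f : M ⟶ N), f ≫ η N = η M ≫ f) (i : ℤ) :
    ∃ p : k[X], ∀ (M : GrWeyl k) (s : k), HasScalar M s → ∀ m ∈ M.comp i,
      (η M).1 m = p.eval s • m := by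
  let a : Weyl k := (η (GrMod.free (Weyl.grading k) i)).1 (1 : Weyl k)
  have h1 : a ∈ Weyl.grading k (i - i) :=
    (η (GrMod.free (Weyl.grading k) i)).2 i (1 : Weyl k) (GrMod.one_mem_free (R := Weyl k) i)
  rw [sub_self] at h1
  obtain ⟨p, hp⟩ := Weyl.exists_eq_aeval h1
  refine ⟨p.comp (Polynomial.X + Polynomial.C (i : k)), fun M s hM m hm => ?_⟩
  have h2 : (η M).1 ((M.freeHom hm).1 (1 : Weyl k)) = MulOpposite.op a • m :=
    congrArg (fun φ => φ.1 (1 : Weyl k)) (hη (M.freeHom hm))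
  rw [GrMod.freeHom_one, hp] at h2
  rw [h2, eval_comp, eval_add, Polynomial.eval_X, eval_C]
  exact aeval_smul (hM i m hm) p

/-- A natural endomorphism of the identity acts on the modules of central character `s` as `p(s)`,
for one polynomial `p`. The polynomials that give the action in different degrees agree at the
infinitely many non-integral scalars, where all the components of `M_c` are nonzero. -/
theorem exists_polynomial [CharZero k]
    (hη : ∀ {M N : GrWeyl k} (f : M ⟶ N), f ≫ η N = η M ≫ f) :
    ∃ p : k[X], ∀ (M : GrWeyl k) (s : k), HasScalar M s → η M = p.eval s • 𝟙 M := by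
  choose P hP using exists_polynomial_degree hη
  have hPi : ∀ i, P i = P 0 := by
    intro i
    refine eq_of_infinite_eval_eq _ _ ?_
    refine Set.infinite_of_injective_forall_mem (f := fun n : ℕ => -((n : k) + 1 / 2)) ?_ ?_
    · intro n n' h
      exact Nat.cast_injective (R := k) (by simpa using h)
    · intro n
      have hc : (n : k) + 1 / 2 ∉ Set.range (Int.cast : ℤ → k) := by
        rintro ⟨l, hl⟩
        have h2 : ((2 * l : ℤ) : k) = ((2 * n + 1 : ℤ) : k) := by
          push_cast
          rw [hl]
          ring
        have h3 := Int.cast_injective h2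
        omega
      have hs : -((n : k) + 1 / 2) ∉ Set.range (Int.cast : ℤ → k) := fun ⟨l, hl⟩ =>
        hc ⟨-l, by rw [Int.cast_neg, hl, neg_neg]⟩
      have hM := hasScalar_M ((n : k) + 1 / 2)
      have hg := quotGen_mem (ha := Weyl.z_add_mem k ((n : k) + 1 / 2))
      obtain ⟨m, hm, h0⟩ := hM.exists_ne_zero hs
        ⟨_, hg, quotGen_ne_zero (Weyl.one_notMem_rightIdeal_z_add _)⟩ i
      obtain ⟨r, -, hr⟩ := exists_eq_smul_quotGen hm
      have h1 := hP i _ _ hM m hm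
      have h2 : (η (M k ((n : k) + 1 / 2))).1 m = (P 0).eval (-((n : k) + 1 / 2)) • m := by
        rw [hr]
        refine (GrMod.hom_op_smul _ _ _).trans ?_
        refine (congrArg _ (hP 0 _ _ hM _ hg)).trans ?_
        exact GrMod.op_smul_comm _ _ _ _
      exact smul_left_injective k h0 (h1.symm.trans h2)
  refine ⟨P 0, fun M s hM => GrMod.hom_ext_homogeneous fun i m hm => ?_⟩
  rw [hP i M s hM m hm, hPi]
  rfl

end EndId

/-- An autoequivalence changes central characters by a polynomial. -/
theorem exists_polynomial_hasScalar_obj [CharZero k] (F : GrWeyl k ⥤ GrWeyl k)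
    [F.Full] [F.Faithful] [F.Linear k] :
    ∃ p : k[X], ∀ (M : GrWeyl k) (s : k), HasScalar M s → HasScalar (F.obj M) (p.eval s) := by
  obtain ⟨p, hp⟩ := exists_polynomial (η := fun M => F.preimage (central (F.obj M)))
    (fun f => F.map_injective (by simp [central_naturality]))
  refine ⟨p, fun M s hM => hasScalar_iff_central.2 ?_⟩
  have h := congrArg F.map (hp M s hM)
  rwa [F.map_preimage, F.map_smul, F.map_id] at h

end GrWeyl

/-! ### The affine map on central characters -/

namespace GrWeyl

open Polynomial

variable {k : Type u} [Field k]

theorem eq_of_iso {M N : GrWeyl k} {s t : k} (hM : HasScalar M s) (hN : HasScalar N t)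
    (e : M ≅ N) (h0 : ∃ i, ∃ m ∈ M.comp i, m ≠ 0) : s = t := by
  obtain ⟨i, m, hm, h0⟩ := h0
  exact hM.unique (hN.of_iso e.symm) hm h0

theorem exists_ne_zero_M (c : k) : ∃ i, ∃ m ∈ (M k c).comp i, m ≠ 0 :=
  ⟨0, _, quotGen_mem, quotGen_ne_zero (Weyl.one_notMem_rightIdeal_z_add c)⟩

/-- If two functors compose to the identity, so do their polynomials. -/
theorem eval_eval_of_iso {F G : GrWeyl k ⥤ GrWeyl k} (e : 𝟭 (GrWeyl k) ≅ F ⋙ G) {p q : k[X]}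
    (hp : ∀ (M : GrWeyl k) (s : k), HasScalar M s → HasScalar (F.obj M) (p.eval s))
    (hq : ∀ (M : GrWeyl k) (s : k), HasScalar M s → HasScalar (G.obj M) (q.eval s)) (s : k) :
    q.eval (p.eval s) = s := by
  have h := hasScalar_M (-s)
  rw [neg_neg] at h
  exact (eq_of_iso h (hq _ _ (hp _ _ h)) (e.app (M k (-s))) (exists_ne_zero_M _)).symm

/-- The integers are the central characters with two simple modules, so an equivalence preserves
them. -/
theorem eval_intCast_mem_range [CharZero k] (F : GrWeyl k ⥤ GrWeyl k) [F.IsEquivalence] {p : k[X]}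
    (hp : ∀ (M : GrWeyl k) (s : k), HasScalar M s → HasScalar (F.obj M) (p.eval s)) (n : ℤ) :
    p.eval (n : k) ∈ Set.range (Int.cast : ℤ → k) := by
  by_contra hn
  have hX := hp _ _ (hasScalar_X_shift (k := k) (-n))
  have hY := hp _ _ (hasScalar_Y_shift (k := k) (-n))
  rw [Int.cast_neg, neg_neg] at hX hY
  have := (isGrSimple_X_shift (k := k) (-n)).simple
  have := (isGrSimple_Y_shift (k := k) (-n)).simple
  have := simple_obj F ((X k).shift (-n))
  have := simple_obj F ((Y k).shift (-n))
  obtain ⟨e⟩ := nonempty_iso_M_of_simple hX hn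
  obtain ⟨e'⟩ := nonempty_iso_M_of_simple hY hn
  exact not_nonempty_X_shift_iso_Y_shift (-n) ⟨F.preimageIso (e ≪≫ e'.symm)⟩

/-- A polynomial with a compositional inverse, both of which preserve the integers, is `±s + b`. -/
theorem exists_eval_eq_of_inverse [CharZero k] {p q : k[X]}
    (hqp : ∀ s, q.eval (p.eval s) = s)
    (hp : ∀ n : ℤ, p.eval (n : k) ∈ Set.range (Int.cast : ℤ → k))
    (hq : ∀ n : ℤ, q.eval (n : k) ∈ Set.range (Int.cast : ℤ → k)) :
    ∃ a b : ℤ, (a = 1 ∨ a = -1) ∧ ∀ s, p.eval s = (a : k) * s - (b : k) := by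
  have hcomp : q.comp p = Polynomial.X :=
    Polynomial.funext fun s => by rw [eval_comp, hqp, Polynomial.eval_X]
  have hdeg : q.natDegree * p.natDegree = 1 := by
    rw [← natDegree_comp, hcomp, natDegree_X]
  obtain ⟨α, β, rfl⟩ := exists_eq_X_add_C_of_natDegree_le_one (Nat.eq_one_of_mul_eq_one_left hdeg).le
  obtain ⟨γ, δ, rfl⟩ := exists_eq_X_add_C_of_natDegree_le_one (Nat.eq_one_of_mul_eq_one_right hdeg).le
  simp only [eval_add, eval_mul, eval_C, Polynomial.eval_X] at hqp hp hq ⊢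
  obtain ⟨b, hb⟩ := hp 0
  obtain ⟨a, ha⟩ := hp 1
  obtain ⟨d, hd⟩ := hq 0
  obtain ⟨c, hc⟩ := hq 1
  have h0 := hqp 0
  have h1 := hqp 1
  simp only [Int.cast_zero, Int.cast_one, mul_zero, mul_one, zero_add] at *
  have hα : ((a - b : ℤ) : k) = α := by
    push_cast
    linear_combination ha - hb
  have hγ : ((c - d : ℤ) : k) = γ := by
    push_cast
    linear_combination hc - hd
  have hunit : (a - b) * (c - d) = 1 := by
    apply Int.cast_injective (α := k)
    rw [Int.cast_mul, hα, hγ, Int.cast_one]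
    linear_combination h1 - h0
  refine ⟨a - b, -b, Int.isUnit_iff.1 (IsUnit.of_mul_eq_one _ hunit), fun s => ?_⟩
  rw [hα, ← hb, Int.cast_neg, sub_neg_eq_add]

end GrWeyl

theorem theorem5p3 {k : Type u} [Field k] [IsAlgClosed k] [CharZero k]
    (F : GrWeyl k ⥤ GrWeyl k) [F.IsEquivalence] [F.Additive] [F.Linear k] :
    ∃ a b : ℤ, (a = 1 ∨ a = -1) ∧
      (∀ n : ℤ, PairIso
        (F.obj ((GrWeyl.X k).shift n)) (F.obj ((GrWeyl.Y k).shift n))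
        ((GrWeyl.X k).shift (a * n + b)) ((GrWeyl.Y k).shift (a * n + b))) ∧
      (∀ c : k, c ∉ Set.range (Int.cast : ℤ → k) →
        Nonempty (F.obj (GrWeyl.M k c) ≅ GrWeyl.M k ((a : k) * c + (b : k)))) ∧
      (∀ a' b' : ℤ, (a' = 1 ∨ a' = -1) →
        (∀ n : ℤ, PairIso
          (F.obj ((GrWeyl.X k).shift n)) (F.obj ((GrWeyl.Y k).shift n))
          ((GrWeyl.X k).shift (a' * n + b')) ((GrWeyl.Y k).shift (a' * n + b'))) →
        a' = a ∧ b' = b) := by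
  obtain ⟨p, hp⟩ := GrWeyl.exists_polynomial_hasScalar_obj F
  have : F.asEquivalence.functor.Linear k := inferInstanceAs (F.Linear k)
  have : F.inv.Linear k := F.asEquivalence.inverseLinear k
  obtain ⟨q, hq⟩ := GrWeyl.exists_polynomial_hasScalar_obj F.inv
  obtain ⟨a, b, ha, hab⟩ := GrWeyl.exists_eval_eq_of_inverse
    (GrWeyl.eval_eval_of_iso F.asEquivalence.unitIso hp hq)
    (GrWeyl.eval_intCast_mem_range F hp) (GrWeyl.eval_intCast_mem_range F.inv hq)
  have hneg : ∀ n : ℤ, p.eval (-(n : k)) = -((a * n + b : ℤ) : k) := fun n => by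
    rw [hab]
    push_cast
    ring
  have hX : ∀ n : ℤ, GrWeyl.HasScalar (F.obj ((GrWeyl.X k).shift n)) (-((a * n + b : ℤ) : k)) :=
    fun n => hneg n ▸ hp _ _ (GrWeyl.hasScalar_X_shift n)
  have hY : ∀ n : ℤ, GrWeyl.HasScalar (F.obj ((GrWeyl.Y k).shift n)) (-((a * n + b : ℤ) : k)) :=
    fun n => hneg n ▸ hp _ _ (GrWeyl.hasScalar_Y_shift n)
  have hXs : ∀ n : ℤ, Simple (F.obj ((GrWeyl.X k).shift n)) := fun n => by
    have := (GrWeyl.isGrSimple_X_shift (k := k) n).simple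
    exact simple_obj F _
  have hYs : ∀ n : ℤ, Simple (F.obj ((GrWeyl.Y k).shift n)) := fun n => by
    have := (GrWeyl.isGrSimple_Y_shift (k := k) n).simple
    exact simple_obj F _
  refine ⟨a, b, ha, fun n => ?_, fun c hc => ?_, fun a' b' _ h => ?_⟩
  · have hne : ∀ {Z : GrWeyl k}, (F.obj ((GrWeyl.X k).shift n) ≅ Z) →
        (F.obj ((GrWeyl.Y k).shift n) ≅ Z) → False := fun e e' =>
      GrWeyl.not_nonempty_X_shift_iso_Y_shift n ⟨F.preimageIso (e ≪≫ e'.symm)⟩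
    rcases GrWeyl.nonempty_iso_X_or_Y_of_simple (hX n) with ⟨⟨e⟩⟩ | ⟨⟨e⟩⟩ <;>
      rcases GrWeyl.nonempty_iso_X_or_Y_of_simple (hY n) with ⟨⟨e'⟩⟩ | ⟨⟨e'⟩⟩
    · exact (hne e e').elim
    · exact Or.inl ⟨⟨e⟩, ⟨e'⟩⟩
    · exact Or.inr ⟨⟨e⟩, ⟨e'⟩⟩
    · exact (hne e e').elim
  · have hs : p.eval (-c) ∉ Set.range (Int.cast : ℤ → k) := by
      rintro ⟨l, hl⟩
      rw [hab] at hl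
      rcases ha with rfl | rfl
      · exact hc ⟨-l - b, by push_cast at hl ⊢; linear_combination -hl⟩
      · exact hc ⟨l + b, by push_cast at hl ⊢; linear_combination hl⟩
    have := (GrWeyl.isGrSimple_M hc).simple
    have := simple_obj F (GrWeyl.M k c)
    have h := GrWeyl.nonempty_iso_M_of_simple (hp _ _ (GrWeyl.hasScalar_M c)) hs
    rwa [hab, show -((a : k) * -c - (b : k)) = (a : k) * c + (b : k) by ring] at h
  · have key : ∀ n : ℤ, a' * n + b' = a * n + b := fun n => by
      have h1 : -((a * n + b : ℤ) : k) = -((a' * n + b' : ℤ) : k) := by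
        rcases h n with ⟨⟨e⟩, -⟩ | ⟨⟨e⟩, -⟩
        · exact GrWeyl.eq_of_iso (hX n) (GrWeyl.hasScalar_X_shift _) e
            (GrWeyl.exists_ne_zero_of_simple _)
        · exact GrWeyl.eq_of_iso (hX n) (GrWeyl.hasScalar_Y_shift _) e
            (GrWeyl.exists_ne_zero_of_simple _)
      exact (Int.cast_injective (neg_injective h1)).symm
    have h0 := key 0
    have h1 := key 1
    constructor <;> linarith
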